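/- Let $1\le p\le\infty$ and let $\ell^p$ be the space of complex sequences indexed by the positive integers. Let $\mathcal W$ be the Wiener class of Laurent series $a(z)=\sum_{j\in\mathbb Z}a_jz^j$ with $\sum_{j}|a_j|<\infty$; for $a\in\mathcal W$ let $T(a)=[a_{j-i}]_{i,j\ge1}$ be the Toeplitz operator on $\ell^p$ with symbol $a$, and let $\mathcal{QT}_p$ be the set of operators $T(a)+E$ with $a\in\mathcal W$ and $E$ compact on $\ell^p$. Let $A=T(a)+E_a$, $B=T(b)+E_b$, $C=T(c)+E_c$ be in $\mathcal{QT}_p$, with $a,b,c\in\mathcal W$ and $E_a,E_b,E_c$ compact, and suppose that the spectra of $A$ and $-B$ (as bounded operators on $\ell^p$) are disjoint: $\sigma(A)\cap\sigma(-B)=\emptyset$. Then the Sylvester equation $AX+XB+C=0$ has a unique bounded solution $X$ on $\ell^p$, one has $a(z)+b(z)\neq0$ for all $|z|=1$, and $X$ lies in $\mathcal{QT}_p$. More precisely, $X=T(x)+E_x$, where $x\in\mathcal W$ has the values $$x(z)=-c(z)\,(a(z)+b(z))^{-1}\qquad(|z|=1),$$ and $E_x$ is a compact operator on $\ell^p$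 that solves the correction equation $$AE_x+E_xB+\bigl(C+AT(x)+T(x)B\bigr)=0 .$$ -/

import Mathlib

/-- The sequence space `ℓ^p` of complex sequences, `1 ≤ p ≤ ∞`, as a complex Banach space. -/
abbrev SeqSpace (p : ENNReal) : Type := lp (fun _ : ℕ => ℂ) p

/-- The Wiener class: absolutely summable families `(a_j)_{j ∈ ℤ}` of Laurent coefficients. -/
abbrev Wiener : Type := lp (fun _ : ℤ => ℂ) 1

/-- The value `a(z) = ∑_{j ∈ ℤ} a_j z^j` of a Laurent series; for `a` in the Wiener class the
series converges absolutely at every `z` on the unit circle. -/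
noncomputable def Wiener.eval (a : Wiener) (z : ℂ) : ℂ := ∑' j : ℤ, a j * z ^ j

theorem Wiener.summable_norm (a : Wiener) : Summable (fun j : ℤ => ‖a j‖) := by
  have h := (lp.memℓp a).summable (by simp)
  simpa using h

/-- Auxiliary: the sequence `i ↦ x_{i+k}`, where `x` is extended by zero to negative indices. -/
def zshift (k : ℤ) (x : ℕ → ℂ) (i : ℕ) : ℂ := if 0 ≤ (i : ℤ) + k then x ((i : ℤ) + k).toNat else 0

theorem norm_zshift_le {p : ENNReal} [Fact (1 ≤ p)] (k : ℤ) (x : SeqSpace p) (i : ℕ) :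
    ‖zshift k x i‖ ≤ ‖x‖ := by
  have hp : p ≠ 0 := (lt_of_lt_of_le zero_lt_one Fact.out).ne'
  unfold zshift
  split_ifs
  · exact lp.norm_apply_le_norm hp x _
  · simp

theorem sum_zshift_le {p : ENNReal} [Fact (1 ≤ p)] (hp : p ≠ ⊤) (k : ℤ) (x : SeqSpace p)
    (s : Finset ℕ) : ∑ i ∈ s, ‖zshift k x i‖ ^ p.toReal ≤ ‖x‖ ^ p.toReal := by
  have hp0 : 0 < p.toReal :=
    ENNReal.toReal_pos (lt_of_lt_of_le zero_lt_one Fact.out).ne' hp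
  classical
  have h1 : ∑ i ∈ s, ‖zshift k x i‖ ^ p.toReal
      = ∑ i ∈ s.filter (fun i : ℕ => 0 ≤ (i : ℤ) + k), ‖x ((i : ℤ) + k).toNat‖ ^ p.toReal := by
    rw [Finset.sum_filter]
    refine Finset.sum_congr rfl fun i _ => ?_
    unfold zshift
    split_ifs
    · rfl
    · simp [Real.zero_rpow hp0.ne']
  have hinj : Set.InjOn (fun i : ℕ => ((i : ℤ) + k).toNat)
      (s.filter (fun i : ℕ => 0 ≤ (i : ℤ) + k) : Finset ℕ) := by
    intro i hi j hj hij
    simp only [Finset.coe_filter, Set.mem_ofPred_eq] at hi hj hij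
    omega
  rw [h1, ← Finset.sum_image (f := fun n => ‖x n‖ ^ p.toReal) hinj]
  exact lp.sum_rpow_le_norm_rpow hp0 x _

theorem memℓp_zshift {p : ENNReal} [Fact (1 ≤ p)] (k : ℤ) (x : SeqSpace p) :
    Memℓp (E := fun _ : ℕ => ℂ) (zshift k x) p := by
  rcases eq_or_ne p ⊤ with rfl | hp
  · exact memℓp_infty ⟨‖x‖, by rintro _ ⟨i, rfl⟩; exact norm_zshift_le k x i⟩
  · exact memℓp_gen' (sum_zshift_le hp k x)

theorem norm_zshift_lp_le {p : ENNReal} [Fact (1 ≤ p)] (k : ℤ) (x : SeqSpace p) :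
    ‖(⟨zshift k x, memℓp_zshift k x⟩ : SeqSpace p)‖ ≤ ‖x‖ := by
  rcases eq_or_ne p ⊤ with rfl | hp
  · exact lp.norm_le_of_forall_le (norm_nonneg _) (norm_zshift_le k x)
  · exact lp.norm_le_of_forall_sum_le
      (ENNReal.toReal_pos (lt_of_lt_of_le zero_lt_one Fact.out).ne' hp) (norm_nonneg _)
      (sum_zshift_le hp k x)

theorem summable_toeplitz_row {p : ENNReal} [Fact (1 ≤ p)] (a : Wiener) (x : SeqSpace p) (i : ℕ) :
    Summable (fun j : ℕ => a ((j : ℤ) - (i : ℤ)) * x j) := by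
  have hp : p ≠ 0 := (lt_of_lt_of_le zero_lt_one Fact.out).ne'
  have hinj : Function.Injective (fun j : ℕ => (j : ℤ) - (i : ℤ)) := by
    intro j j' h
    simpa using h
  refine Summable.of_norm_bounded ((a.summable_norm.comp_injective hinj).mul_right ‖x‖) fun j => ?_
  rw [norm_mul]
  exact mul_le_mul_of_nonneg_left (lp.norm_apply_le_norm hp x j) (norm_nonneg _)

theorem toeplitz_exists {p : ENNReal} [Fact (1 ≤ p)] (a : Wiener) (x : SeqSpace p) :
    ∃ y : SeqSpace p, ‖y‖ ≤ ‖a‖ * ‖x‖ ∧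
      ∀ i : ℕ, y i = ∑' j : ℕ, a ((j : ℤ) - (i : ℤ)) * x j := by
  have hp : p ≠ 0 := (lt_of_lt_of_le zero_lt_one Fact.out).ne'
  let v : ℤ → SeqSpace p := fun k => a k • ⟨zshift k x, memℓp_zshift k x⟩
  have hv : ∀ k, ‖v k‖ ≤ ‖a k‖ * ‖x‖ := fun k => by
    rw [norm_smul]
    exact mul_le_mul_of_nonneg_left (norm_zshift_lp_le k x) (norm_nonneg _)
  have hs : Summable (fun k => ‖a k‖ * ‖x‖) := a.summable_norm.mul_right _
  have hvs : Summable v := Summable.of_norm_bounded hs hv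
  have hna : ‖a‖ = ∑' k, ‖a k‖ := by
    rw [lp.norm_eq_tsum_rpow (by simp)]
    simp
  refine ⟨∑' k, v k, ?_, fun i => ?_⟩
  · rw [hna, ← tsum_mul_right]
    exact tsum_of_norm_bounded hs.hasSum hv
  · have h1 : (∑' k, v k : SeqSpace p) i = ∑' k, (v k) i :=
      (lp.evalCLM ℂ (fun _ : ℕ => ℂ) p i).map_tsum hvs
    have hinj : Function.Injective (fun j : ℕ => (j : ℤ) - (i : ℤ)) := by
      intro j j' h
      simpa using h
    rw [h1, ← hinj.tsum_eq]
    · refine tsum_congr fun j => ?_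
      change a ((j : ℤ) - i) * zshift ((j : ℤ) - i) x i = _
      simp [zshift]
    · intro k hk
      rw [Function.mem_support] at hk
      change a k * zshift k x i ≠ 0 at hk
      have h0 : 0 ≤ (i : ℤ) + k := by
        by_contra hneg
        exact hk (by simp [zshift, hneg])
      exact ⟨((i : ℤ) + k).toNat, by simp only [Int.toNat_of_nonneg h0]; ring⟩

/-- The Toeplitz operator `T(a)` on `ℓ^p`, given by the semi-infinite matrix `[a_{j-i}]`:
`(T(a) x)_i = ∑_j a_{j-i} x_j`. -/
noncomputable def toeplitz (p : ENNReal) [Fact (1 ≤ p)] (a : Wiener) :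
    SeqSpace p →L[ℂ] SeqSpace p :=
  LinearMap.mkContinuous
    { toFun := fun x => ⟨fun i => ∑' j : ℕ, a ((j : ℤ) - (i : ℤ)) * x j, by
        obtain ⟨y, -, hy⟩ := toeplitz_exists a x
        rw [← funext hy]
        exact lp.memℓp y⟩
      map_add' := fun x y => by
        ext i
        change ∑' j : ℕ, a ((j : ℤ) - (i : ℤ)) * (x j + y j) = _ + _
        simp only [mul_add]
        exact (summable_toeplitz_row a x i).tsum_add (summable_toeplitz_row a y i)
      map_smul' := fun r x => by
        ext i
        change ∑' j : ℕ, a ((j : ℤ) - (i : ℤ)) * (r * x j) = r * _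
        rw [← tsum_mul_left]
        exact tsum_congr fun j => by ring }
    ‖a‖ (fun x => by
      obtain ⟨y, hn, hy⟩ := toeplitz_exists a x
      refine le_trans (le_of_eq (congrArg norm ?_)) hn
      exact lp.ext (funext fun i => (hy i).symm))

theorem toeplitz_apply (p : ENNReal) [Fact (1 ≤ p)] (a : Wiener) (x : SeqSpace p) (i : ℕ) :
    toeplitz p a x i = ∑' j : ℕ, a ((j : ℤ) - (i : ℤ)) * x j := rfl

/-- The class `QT_p` of quasi-Toeplitz operators on `ℓ^p`: Toeplitz operators with symbol in the
Wiener class plus a compact operator. -/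
def QT (p : ENNReal) [Fact (1 ≤ p)] : Set (SeqSpace p →L[ℂ] SeqSpace p) :=
  {A | ∃ (a : Wiener) (E : SeqSpace p →L[ℂ] SeqSpace p),
    IsCompactOperator E ∧ A = toeplitz p a + E}

/-- `X` solves the Sylvester equation `A X + X B + C = 0`. -/
def SolvesSylvester {p : ENNReal} [Fact (1 ≤ p)] (A B C X : SeqSpace p →L[ℂ] SeqSpace p) : Prop :=
  A ∘L X + X ∘L B + C = 0

/-!
The argument has three independent ingredients.

*Rosenblum's theorem in ideals.* On a closed two-sided ideal `W` of a complex Banach algebra, the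
left multiplication by `A` and the right multiplication by `B` commute, and their spectra lie in
those of `A` and `B`. Gelfand theory in the double centralizer of two commuting elements shows that
their sum is invertible when `σ(A)` and `σ(-B)` are disjoint
(`existsUnique_sylvester_of_disjoint_spectrum`). Taking for `W` all operators gives the unique
bounded solution; taking for `W` the compact operators, a compact right-hand side gives a compact
solution.

*Symbols and spectra.* The values `a(z)`, `|z| = 1`, lie in the spectrum of `T(a) + E` for every
compact `E` (`eval_mem_spectrum_toeplitz_add`), since approximate eigenvectors of the forward shift
are approximate eigenvectors of `T(a)`. A zero of `a + b` on the unit circle would thus be a common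
point of `σ(A)` and `σ(-B)`.

*Wiener's lemma and compactness.* As `a + b` has no zeros on the circle, multiplication by `a + b`
is invertible on the Wiener class (`Wiener.isUnit_conv`), which provides `x = -c / (a + b)`. The
symbol map is multiplicative modulo compact operators (`isCompactOperator_toeplitz_conv_sub`), so
the residual `C + A T(x) + T(x) B` is compact and the correction equation has a compact solution
`Ex`. By uniqueness, `X = T(x) + Ex`.
-/

/-! ### Characters on double centralizers -/

/-- The double centralizer of a subset of a complex algebra. -/
abbrev doubleCentralizer {R : Type*} [Ring R] [Algebra ℂ R] (S : Set R) : Subalgebra ℂ R :=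
  Subalgebra.centralizer ℂ S.centralizer

/-- If `x` lies in the double centralizer of a commuting subset `S` of a complex Banach algebra and
is not invertible, then some character of the double centralizer vanishes at `x`. The double
centralizer is a commutative Banach algebra closed under inverses, so its characters take their
values in the spectra of the ambient algebra. -/
theorem exists_character_apply_eq_zero {R : Type*} [NormedRing R] [NormedAlgebra ℂ R]
    [CompleteSpace R] {S : Set R} (hS : ∀ x ∈ S, ∀ y ∈ S, x * y = y * x)
    (x : doubleCentralizer S) (hx : ¬ IsUnit (x : R)) :
    ∃ φ : doubleCentralizer S →ₐ[ℂ] ℂ,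
      φ x = 0 ∧ ∀ y : doubleCentralizer S, φ y ∈ spectrum ℂ (y : R) := by
  have hcomm : ∀ u v : doubleCentralizer S, u * v = v * u := fun u v =>
    Subtype.ext (Set.centralizer_centralizer_comm_of_comm hS _ u.2 _ v.2)
  have hclosed : IsClosed (doubleCentralizer S : Set R) := Set.isClosed_centralizer _
  have hcomplete : CompleteSpace (doubleCentralizer S) := hclosed.completeSpace_coe
  have hunit : ∀ y : doubleCentralizer S, IsUnit (y : R) → IsUnit y := by
    rintro y ⟨u, hu⟩
    have hinv : (↑u⁻¹ : R) ∈ doubleCentralizer S := by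
      rw [Subalgebra.mem_centralizer_iff]
      intro g hg
      have h := Subalgebra.mem_centralizer_iff ℂ |>.1 y.2 g hg
      rw [← hu] at h
      have h' : Commute g (u : R) := h
      exact h'.units_inv_right
    refine ⟨⟨y, ⟨_, hinv⟩, Subtype.ext ?_, Subtype.ext ?_⟩, rfl⟩
    · change (y : R) * ↑u⁻¹ = 1
      rw [← hu, Units.mul_inv]
    · change ↑u⁻¹ * (y : R) = 1
      rw [← hu, Units.inv_mul]
  let _ : NormedCommRing (doubleCentralizer S) :=
    { (inferInstance : NormedRing (doubleCentralizer S)) with mul_comm := hcomm }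
  have hx' : ¬ IsUnit x := fun h => hx (h.map (doubleCentralizer S).val)
  obtain ⟨f, hf⟩ := WeakDual.CharacterSpace.exists_apply_eq_zero (A := doubleCentralizer S) hx'
  refine ⟨WeakDual.CharacterSpace.toAlgHom f, hf, fun y hy => ?_⟩
  have h1 := hunit (algebraMap ℂ _ _ - y) hy
  exact AlgHom.apply_mem_spectrum (WeakDual.CharacterSpace.toAlgHom f) y h1

/-- Two commuting elements `P`, `Q` of a complex Banach algebra such that `σ(P)` and `σ(-Q)` are
disjoint have an invertible sum. -/
theorem isUnit_add_of_disjoint_spectrum {R : Type*} [NormedRing R] [NormedAlgebra ℂ R]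
    [CompleteSpace R] {P Q : R} (hPQ : P * Q = Q * P)
    (h : spectrum ℂ P ∩ spectrum ℂ (-Q) = ∅) : IsUnit (P + Q) := by
  by_contra hne
  have hS : ∀ x ∈ ({P, Q} : Set R), ∀ y ∈ ({P, Q} : Set R), x * y = y * x := by
    rintro x (rfl | rfl) y (rfl | rfl) <;> simp [hPQ]
  have hsub := Set.subset_centralizer_centralizer (S := ({P, Q} : Set R))
  let P' : doubleCentralizer ({P, Q} : Set R) := ⟨P, hsub (by simp)⟩
  let Q' : doubleCentralizer ({P, Q} : Set R) := ⟨Q, hsub (by simp)⟩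
  obtain ⟨φ, h0, hφ⟩ := exists_character_apply_eq_zero hS (P' + Q') hne
  have hQ : φ P' = φ (-Q') := by
    rw [map_neg, eq_neg_iff_add_eq_zero, ← map_add, h0]
  have hmem : φ P' ∈ spectrum ℂ P ∩ spectrum ℂ (-Q) := ⟨hφ P', hQ ▸ hφ (-Q')⟩
  simp [h] at hmem

/-! ### Sylvester equations in a closed ideal -/

section Ideal

variable {R : Type*} [NormedRing R] [NormedAlgebra ℂ R] (W : Submodule ℂ R)

/-- Left multiplications, as bounded operators on a subspace `W` that they leave invariant. -/
noncomputable def leftMulOn (hW : ∀ a : R, ∀ k ∈ W, a * k ∈ W) : R →ₐ[ℂ] (W →L[ℂ] W) :=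
  AlgHom.ofLinearMap
    { toFun := fun a => (((ContinuousLinearMap.mul ℂ R a).comp W.subtypeL).codRestrict W
        fun k => hW a k k.2)
      map_add' := fun a b => by ext k; exact add_mul a b (k : R)
      map_smul' := fun r a => by ext k; exact smul_mul_assoc r a (k : R) }
    (by ext k; exact one_mul (k : R)) (fun a b => by ext k; exact mul_assoc a b (k : R))

/-- Right multiplications, as bounded operators on a subspace `W` that they leave invariant. The
opposite algebra turns the antihomomorphism into a homomorphism. -/
noncomputable def rightMulOn (hW : ∀ a : R, ∀ k ∈ W, k * a ∈ W) : Rᵐᵒᵖ →ₐ[ℂ] (W →L[ℂ] W) :=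
  AlgHom.ofLinearMap
    { toFun := fun a => ((((ContinuousLinearMap.mul ℂ R).flip a.unop).comp W.subtypeL).codRestrict W
        fun k => hW a.unop k k.2)
      map_add' := fun a b => by ext k; exact mul_add (k : R) a.unop b.unop
      map_smul' := fun r a => by ext k; exact mul_smul_comm r (k : R) a.unop }
    (by ext k; exact mul_one (k : R))
    (fun a b => by ext k; exact (mul_assoc (k : R) b.unop a.unop).symm)

/-- The case of operators on a Banach space. Stating it separately keeps the unification of the
algebra structures on `V →L[ℂ] V` cheap when `V` is a subspace. -/
theorem isUnit_clm_add_of_disjoint_spectrum {V : Type*} [NormedAddCommGroup V] [NormedSpace ℂ V]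
    [CompleteSpace V] {P Q : V →L[ℂ] V} (hPQ : P * Q = Q * P)
    (h : spectrum ℂ P ∩ spectrum ℂ (-Q) = ∅) : IsUnit (P + Q) :=
  isUnit_add_of_disjoint_spectrum hPQ h

theorem isUnit_leftMulOn_add_rightMulOn [CompleteSpace W]
    (hl : ∀ a : R, ∀ k ∈ W, a * k ∈ W) (hr : ∀ a : R, ∀ k ∈ W, k * a ∈ W) {A B : R}
    (h : spectrum ℂ A ∩ spectrum ℂ (-B) = ∅) :
    IsUnit (leftMulOn W hl A + rightMulOn W hr (MulOpposite.op B)) := by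
  have hP : spectrum ℂ (leftMulOn W hl A) ⊆ spectrum ℂ A := AlgHom.spectrum_apply_subset _ A
  have hQ : spectrum ℂ (-rightMulOn W hr (MulOpposite.op B)) ⊆ spectrum ℂ (-B) := by
    rw [← map_neg (rightMulOn W hr), ← MulOpposite.op_neg]
    exact (AlgHom.spectrum_apply_subset (rightMulOn W hr) _).trans
      fun z hz hu => hz (isUnit_op.2 hu)
  have hPQ : leftMulOn W hl A * rightMulOn W hr (MulOpposite.op B)
      = rightMulOn W hr (MulOpposite.op B) * leftMulOn W hl A := by
    ext k
    exact (mul_assoc A (k : R) B).symm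
  have hd := Set.subset_eq_empty (Set.inter_subset_inter hP hQ) h
  exact isUnit_clm_add_of_disjoint_spectrum hPQ hd

/-- Rosenblum's theorem, in a closed two-sided ideal `W` of a complex Banach algebra: the operator
`X ↦ AX + XB` on `W` is bijective when `σ(A)` and `σ(-B)` are disjoint. -/
theorem existsUnique_sylvester_of_disjoint_spectrum [CompleteSpace R] (hc : IsClosed (W : Set R))
    (hl : ∀ a : R, ∀ k ∈ W, a * k ∈ W) (hr : ∀ a : R, ∀ k ∈ W, k * a ∈ W) {A B : R}
    (h : spectrum ℂ A ∩ spectrum ℂ (-B) = ∅) {K : R} (hK : K ∈ W) :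
    ∃! X, X ∈ W ∧ A * X + X * B = K := by
  have : CompleteSpace W := hc.completeSpace_coe
  have hbij := ContinuousLinearMap.isUnit_iff_bijective.1
    (isUnit_leftMulOn_add_rightMulOn W hl hr h)
  have happ : ∀ X : W, ((leftMulOn W hl A + rightMulOn W hr (MulOpposite.op B)) X : R)
      = A * X + X * B := fun X => rfl
  obtain ⟨X, hX⟩ := hbij.2 ⟨K, hK⟩
  refine ⟨X, ⟨X.2, ?_⟩, ?_⟩
  · rw [← happ, hX]
  · rintro Y ⟨hY, hYe⟩
    have : (⟨Y, hY⟩ : W) = X := hbij.1 (by rw [hX]; exact Subtype.ext hYe)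
    exact congrArg Subtype.val this

end Ideal

/-! ### The Wiener algebra -/

namespace Wiener

/-- The monomial `z ^ k`, as an element of the Wiener class. -/
noncomputable def monomial (k : ℤ) : Wiener := lp.single 1 k (1 : ℂ)

theorem monomial_apply (k j : ℤ) : monomial k j = if j = k then 1 else 0 := by
  simp [monomial, lp.single_apply, Pi.single_apply]

theorem norm_monomial (k : ℤ) : ‖monomial k‖ = 1 := by
  simp [monomial, lp.norm_single]

theorem norm_eq_tsum (a : Wiener) : ‖a‖ = ∑' k, ‖a k‖ := by
  rw [lp.norm_eq_tsum_rpow (by simp)]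
  simp

theorem hasSum_monomial (a : Wiener) : HasSum (fun k => a k • monomial k) a := by
  refine (lp.hasSum_single ENNReal.one_ne_top a).congr_fun fun k => ?_
  rw [monomial, ← lp.single_smul]
  simp

variable {F : Type*} [NormedAddCommGroup F] [NormedSpace ℂ F]

/-- The monomials span a dense subspace of the Wiener class. -/
theorem clm_apply_mem_of_monomial (Φ : Wiener →L[ℂ] F) {K : Submodule ℂ F}
    (hK : IsClosed (K : Set F)) (h : ∀ k, Φ (monomial k) ∈ K) (a : Wiener) : Φ a ∈ K := by
  have hs := (hasSum_monomial a).mapL Φ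
  refine hK.mem_of_tendsto hs (Filter.Eventually.of_forall fun s => K.sum_mem fun k _ => ?_)
  rw [map_smul]
  exact K.smul_mem _ (h k)

theorem clm_ext {Φ Ψ : Wiener →L[ℂ] F} (h : ∀ k, Φ (monomial k) = Ψ (monomial k)) : Φ = Ψ := by
  ext1 a
  have := clm_apply_mem_of_monomial (Φ - Ψ) (K := ⊥) (by simp) (fun k => by simp [h k]) a
  simpa [sub_eq_zero] using this

theorem norm_smul_le_of_norm_le_one {v : ℤ → F} (hv : ∀ k, ‖v k‖ ≤ 1) (a : Wiener) (k : ℤ) :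
    ‖a k • v k‖ ≤ ‖a k‖ := by
  rw [norm_smul]
  exact mul_le_of_le_one_right (norm_nonneg _) (hv k)

theorem summable_smul [CompleteSpace F] {v : ℤ → F} (hv : ∀ k, ‖v k‖ ≤ 1) (a : Wiener) :
    Summable fun k => a k • v k :=
  Summable.of_norm_bounded a.summable_norm (norm_smul_le_of_norm_le_one hv a)

theorem norm_tsum_smul_le {v : ℤ → F} (hv : ∀ k, ‖v k‖ ≤ 1) (a : Wiener) :
    ‖∑' k, a k • v k‖ ≤ 1 * ‖a‖ := by
  rw [one_mul, norm_eq_tsum]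
  exact tsum_of_norm_bounded a.summable_norm.hasSum (norm_smul_le_of_norm_le_one hv a)

/-- The bounded linear map on the Wiener class that takes prescribed values of norm at most `1` at
the monomials. -/
noncomputable def lift [CompleteSpace F] (v : ℤ → F) (hv : ∀ k, ‖v k‖ ≤ 1) : Wiener →L[ℂ] F :=
  LinearMap.mkContinuous
    { toFun := fun a => ∑' k, a k • v k
      map_add' := fun a b => by
        rw [← (summable_smul hv a).tsum_add (summable_smul hv b)]
        exact tsum_congr fun k => add_smul (a k) (b k) (v k)
      map_smul' := fun r a => by
        rw [RingHom.id_apply, ← (summable_smul hv a).tsum_const_smul r]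
        exact tsum_congr fun k => mul_smul r (a k) (v k) }
    1 (norm_tsum_smul_le hv)

section lift

variable [CompleteSpace F] (v : ℤ → F) (hv : ∀ k, ‖v k‖ ≤ 1)

theorem lift_apply (a : Wiener) : lift v hv a = ∑' k, a k • v k := rfl

theorem norm_lift_le : ‖lift v hv‖ ≤ 1 :=
  LinearMap.mkContinuous_norm_le _ zero_le_one (norm_tsum_smul_le hv)

@[simp]
theorem lift_monomial (k : ℤ) : lift v hv (monomial k) = v k := by
  rw [lift_apply, tsum_eq_single k fun j hj => by simp [monomial_apply, hj]]
  simp [monomial_apply]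

end lift

/-- Multiplication by `z ^ k` on the Wiener class. -/
noncomputable def shift (k : ℤ) : Wiener →L[ℂ] Wiener :=
  lift (fun j => monomial (k + j)) fun _ => (norm_monomial _).le

theorem norm_shift_le (k : ℤ) : ‖shift k‖ ≤ 1 := norm_lift_le _ _

/-- Multiplication of Laurent series, that is, convolution of the coefficients. -/
noncomputable def conv : Wiener →L[ℂ] Wiener →L[ℂ] Wiener := lift shift norm_shift_le

/-- Evaluation at a point of the unit circle, as a bounded functional on the Wiener class. -/
noncomputable def evalCLM (z : ℂ) (hz : ‖z‖ = 1) : Wiener →L[ℂ] ℂ :=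
  lift (fun k => z ^ k) fun k => by simp [hz]

theorem evalCLM_apply (z : ℂ) (hz : ‖z‖ = 1) (a : Wiener) : evalCLM z hz a = a.eval z := rfl

theorem shift_monomial (j k : ℤ) : shift j (monomial k) = monomial (j + k) := lift_monomial _ _ k

theorem conv_monomial_left (j : ℤ) : conv (monomial j) = shift j := lift_monomial _ _ j

theorem conv_monomial (j k : ℤ) : conv (monomial j) (monomial k) = monomial (j + k) := by
  rw [conv_monomial_left, shift_monomial]

theorem shift_mul_shift (j k : ℤ) : shift j * shift k = shift (j + k) :=
  clm_ext fun l => by simp [shift, add_assoc]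

theorem shift_zero : shift 0 = 1 := clm_ext fun l => by simp [shift]

theorem conv_comm (a b : Wiener) : conv a b = conv b a := by
  have h : conv = conv.flip := clm_ext fun j => clm_ext fun k => by
    rw [ContinuousLinearMap.flip_apply, conv_monomial, conv_monomial, add_comm]
  exact congrArg (fun Φ : Wiener →L[ℂ] Wiener →L[ℂ] Wiener => Φ a b) h

theorem eval_conv (a b : Wiener) {z : ℂ} (hz : ‖z‖ = 1) :
    (conv a b).eval z = a.eval z * b.eval z := by
  have hz0 : z ≠ 0 := by
    rintro rfl
    simp at hz
  have h : (ContinuousLinearMap.compL ℂ Wiener Wiener ℂ (evalCLM z hz)).comp conv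
      = (ContinuousLinearMap.mul ℂ ℂ).bilinearComp (evalCLM z hz) (evalCLM z hz) := by
    refine clm_ext fun j => clm_ext fun k => ?_
    simp [conv_monomial, evalCLM, zpow_add₀ hz0]
  exact congrArg (fun Φ : Wiener →L[ℂ] Wiener →L[ℂ] ℂ => Φ a b) h

theorem eval_add (a b : Wiener) {z : ℂ} (hz : ‖z‖ = 1) :
    Wiener.eval (a + b) z = a.eval z + b.eval z := map_add (evalCLM z hz) a b

theorem eval_neg (a : Wiener) {z : ℂ} (hz : ‖z‖ = 1) :
    Wiener.eval (-a) z = -a.eval z := map_neg (evalCLM z hz) a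

/-- Wiener's lemma: an absolutely convergent Laurent series without zeros on the unit circle acts
invertibly on the Wiener class by multiplication. A character of the double centralizer of the
shifts sends them to the powers of a unimodular number `z`, hence multiplication by `f` to
`f(z)`. -/
theorem isUnit_conv {f : Wiener} (hf : ∀ z : ℂ, ‖z‖ = 1 → f.eval z ≠ 0) : IsUnit (conv f) := by
  by_contra hne
  have hS : ∀ x ∈ Set.range shift, ∀ y ∈ Set.range shift, x * y = y * x := by
    rintro _ ⟨j, rfl⟩ _ ⟨k, rfl⟩
    rw [shift_mul_shift, shift_mul_shift, add_comm]
  have hsub := Set.subset_centralizer_centralizer (S := Set.range shift)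
  set D := doubleCentralizer (Set.range shift)
  have hclosed : IsClosed (D : Set (Wiener →L[ℂ] Wiener)) := Set.isClosed_centralizer _
  have hmem : ∀ k, shift k ∈ D := fun k => hsub ⟨k, rfl⟩
  have hconv : ∀ a, conv a ∈ Subalgebra.toSubmodule D := fun a =>
    clm_apply_mem_of_monomial conv hclosed (fun k => by rw [conv_monomial_left]; exact hmem k) a
  obtain ⟨φ, h0, hφ⟩ := exists_character_apply_eq_zero hS ⟨conv f, hconv f⟩ hne
  let u : ℤ → D := fun k => ⟨shift k, hmem k⟩
  have hu : ∀ j k, u j * u k = u (j + k) := fun j k => Subtype.ext (shift_mul_shift j k)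
  have hu0 : u 0 = 1 := Subtype.ext shift_zero
  have hcont : ∀ y : D, ‖φ y‖ ≤ 1 * ‖y‖ := fun y => by
    have h1 : ‖φ y‖ ≤ ‖(y : Wiener →L[ℂ] Wiener)‖ * ‖(1 : Wiener →L[ℂ] Wiener)‖ :=
      spectrum.norm_le_norm_mul_of_mem (hφ y)
    rw [one_mul]
    exact h1.trans (mul_le_of_le_one_right (norm_nonneg _) ContinuousLinearMap.norm_id_le)
  have hle : ∀ k, ‖φ (u k)‖ ≤ 1 := fun k =>
    (hcont (u k)).trans (by rw [one_mul]; exact norm_shift_le k)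
  have hinv : φ (u 1) * φ (u (-1)) = 1 := by
    rw [← map_mul, hu, add_neg_cancel, hu0, map_one]
  set z := φ (u 1) with hz
  have hz0 : z ≠ 0 := left_ne_zero_of_mul_eq_one hinv
  have hzinv : φ (u (-1)) = z⁻¹ := eq_inv_of_mul_eq_one_right hinv
  have hz1 : ‖z‖ = 1 := by
    refine le_antisymm (hle 1) ?_
    have := hle (-1)
    rw [hzinv, norm_inv] at this
    exact (inv_le_one₀ (norm_pos_iff.2 hz0)).1 this
  have hpow : ∀ k : ℤ, φ (u k) = z ^ k := by
    intro k
    induction k using Int.induction_on with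
    | zero => rw [hu0, map_one, zpow_zero]
    | succ n ih => rw [← hu, map_mul, ih, zpow_add₀ hz0, zpow_one]
    | pred n ih => rw [sub_eq_add_neg, ← hu, map_mul, ih, hzinv, zpow_add₀ hz0, zpow_neg_one]
  let Φ : D →L[ℂ] ℂ := LinearMap.mkContinuous φ.toLinearMap _ hcont
  let c : Wiener →L[ℂ] D := conv.codRestrict (Subalgebra.toSubmodule D) hconv
  have hΦ : Φ.comp c = evalCLM z hz1 := clm_ext fun k => by
    have hck : c (monomial k) = u k := Subtype.ext (lift_monomial _ _ k)
    rw [ContinuousLinearMap.comp_apply, hck, evalCLM, lift_monomial]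
    exact hpow k
  refine hf z hz1 ?_
  rw [← evalCLM_apply z hz1, ← hΦ]
  exact h0

end Wiener

/-! ### Toeplitz operators modulo compact operators -/

section Toeplitz

variable {p : ENNReal} [Fact (1 ≤ p)]

theorem norm_toeplitz_le (a : Wiener) : ‖toeplitz p a‖ ≤ ‖a‖ :=
  LinearMap.mkContinuous_norm_le _ (norm_nonneg _) _

variable (p) in
/-- The symbol map `a ↦ T(a)`, as a bounded linear map. -/
noncomputable def toeplitzCLM : Wiener →L[ℂ] SeqSpace p →L[ℂ] SeqSpace p :=
  LinearMap.mkContinuous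
    { toFun := toeplitz p
      map_add' := fun a b => by
        ext x i
        change ∑' j : ℕ, (a ((j : ℤ) - i) + b ((j : ℤ) - i)) * x j = _ + _
        simp only [add_mul]
        exact (summable_toeplitz_row a x i).tsum_add (summable_toeplitz_row b x i)
      map_smul' := fun r a => by
        ext x i
        change ∑' j : ℕ, (r * a ((j : ℤ) - i)) * x j = r * ∑' j : ℕ, a ((j : ℤ) - i) * x j
        rw [← tsum_mul_left]
        exact tsum_congr fun j => mul_assoc _ _ _ }
    1 fun a => by
      rw [one_mul]
      exact norm_toeplitz_le a

@[simp]
theorem toeplitzCLM_apply (a : Wiener) : toeplitzCLM p a = toeplitz p a := rfl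

theorem toeplitz_monomial_apply (k : ℤ) (x : SeqSpace p) (i : ℕ) :
    toeplitz p (Wiener.monomial k) x i = zshift k x i := by
  rw [toeplitz_apply, zshift]
  split_ifs with h
  · rw [tsum_eq_single ((i : ℤ) + k).toNat]
    · rw [Wiener.monomial_apply, if_pos (by omega), one_mul]
    · intro j hj
      rw [Wiener.monomial_apply, if_neg (by omega), zero_mul]
  · have : ∀ j : ℕ, Wiener.monomial k ((j : ℤ) - i) * x j = 0 := fun j => by
      rw [Wiener.monomial_apply, if_neg (by omega), zero_mul]
    simp [this]

theorem norm_toeplitz_monomial_le (k : ℤ) : ‖toeplitz p (Wiener.monomial k)‖ ≤ 1 :=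
  (norm_toeplitz_le _).trans (Wiener.norm_monomial k).le

theorem toeplitz_monomial_comp (j k : ℤ) (h : 0 ≤ j ∨ k ≤ 0) (x : SeqSpace p) :
    toeplitz p (Wiener.monomial j) (toeplitz p (Wiener.monomial k) x)
      = toeplitz p (Wiener.monomial (j + k)) x := by
  ext i
  rw [toeplitz_monomial_apply, toeplitz_monomial_apply, zshift, zshift]
  split_ifs with h1 h2 h2
  · rw [toeplitz_monomial_apply, zshift, if_pos (by omega)]
    exact congrArg (x : ℕ → ℂ) (by omega)
  · rw [toeplitz_monomial_apply, zshift, if_neg (by omega)]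
  · omega
  · rfl

theorem toeplitz_monomial_zero (x : SeqSpace p) : toeplitz p (Wiener.monomial 0) x = x := by
  ext i
  simp [toeplitz_monomial_apply, zshift]

/-- An operator whose values are supported in a fixed finite set has finite rank. -/
theorem isCompactOperator_of_apply_eq_zero (D : SeqSpace p →L[ℂ] SeqSpace p) (N : ℕ)
    (h : ∀ x i, N ≤ i → D x i = 0) : IsCompactOperator D := by
  let R : ℕ → SeqSpace p →L[ℂ] SeqSpace p := fun i =>
    (lp.singleContinuousLinearMap ℂ (fun _ : ℕ => ℂ) p i).comp
      ((lp.evalCLM ℂ (fun _ : ℕ => ℂ) p i).comp D)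
  have hR : ∀ i, R i ∈ compactOperator (RingHom.id ℂ) (SeqSpace p) (SeqSpace p) := fun i =>
    (isCompactOperator_of_locallyCompactSpace_dom
      ((lp.evalCLM ℂ (fun _ : ℕ => ℂ) p i).comp D)).clm_comp
        (lp.singleContinuousLinearMap ℂ (fun _ : ℕ => ℂ) p i)
  have hD : D = ∑ i ∈ Finset.range N, R i := by
    ext x j
    have hc : (∑ i ∈ Finset.range N, R i) x j = ∑ i ∈ Finset.range N, R i x j := by
      rw [sum_apply]
      exact map_sum (lp.evalCLM ℂ (fun _ : ℕ => ℂ) p j) _ _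
    have hv : ∀ i, R i x j = if j = i then D x j else 0 := fun i => by
      change lp.single (E := fun _ : ℕ => ℂ) p i (D x i) j = _
      split_ifs with hij
      · subst hij
        simp
      · exact lp.single_apply_ne p i _ hij
    rw [hc]
    simp only [hv, Finset.sum_ite_eq, Finset.mem_range]
    split_ifs with hj
    · rfl
    · exact h x j (not_lt.1 hj)
  rw [hD]
  exact Submodule.sum_mem _ fun i _ => hR i

/-- The symbol map is multiplicative modulo compact operators: on monomials the defect has finite
rank, and the monomials span a dense subspace of the Wiener class. -/
theorem isCompactOperator_toeplitz_conv_sub (a b : Wiener) :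
    IsCompactOperator
      (toeplitz p (Wiener.conv a b) - toeplitz p b ∘L toeplitz p a) := by
  have hK : IsClosed (compactOperator (RingHom.id ℂ) (SeqSpace p) (SeqSpace p) :
      Set (SeqSpace p →L[ℂ] SeqSpace p)) := isClosed_setOfPred_isCompactOperator
  let Φ : Wiener →L[ℂ] Wiener →L[ℂ] SeqSpace p →L[ℂ] SeqSpace p :=
    (ContinuousLinearMap.compL ℂ Wiener Wiener (SeqSpace p →L[ℂ] SeqSpace p)
        (toeplitzCLM p)).comp Wiener.conv
      - ((ContinuousLinearMap.mul ℂ (SeqSpace p →L[ℂ] SeqSpace p)).flip).bilinearComp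
          (toeplitzCLM p) (toeplitzCLM p)
  have hΦ : ∀ a b, Φ a b = toeplitz p (Wiener.conv a b) - toeplitz p b ∘L toeplitz p a :=
    fun a b => rfl
  rw [← hΦ]
  refine Wiener.clm_apply_mem_of_monomial (Φ a) hK (fun k => ?_) b
  refine Wiener.clm_apply_mem_of_monomial (Φ.flip (Wiener.monomial k)) hK (fun j => ?_) a
  rw [ContinuousLinearMap.flip_apply, hΦ, Wiener.conv_monomial]
  refine isCompactOperator_of_apply_eq_zero _ (-k).toNat fun x i hi => ?_
  change toeplitz p (Wiener.monomial (j + k)) x i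
    - toeplitz p (Wiener.monomial k) (toeplitz p (Wiener.monomial j) x) i = 0
  rw [toeplitz_monomial_apply, toeplitz_monomial_apply, zshift, zshift, sub_eq_zero,
    if_pos (show 0 ≤ (i : ℤ) + k by omega), toeplitz_monomial_apply, zshift]
  split_ifs with h1 h2 h2
  · exact congrArg (x : ℕ → ℂ) (by omega)
  · omega
  · omega
  · rfl

/-! ### The range of the symbol lies in the spectrum -/

/-- A unimodular `w` is an approximate eigenvalue of the forward shift `U`. With `V = w⁻¹U` and
`Q = ∑_{m ≤ n} V ^ m`, a lower bound `c` for `V - 1` would give `c ^ 2 * ‖Q (Q e₀)‖ ≤ 4` for all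
`n`, because `(V - 1) Q = V ^ (n + 1) - 1` is bounded by `2`; but the `n`-th coordinate of
`Q (Q e₀)` has modulus `n + 1`. -/
theorem exists_norm_shift_sub_lt {w : ℂ} (hw : ‖w‖ = 1) {c : ℝ} (hc : 0 < c) :
    ∃ x : SeqSpace p, ‖toeplitz p (Wiener.monomial (-1)) x - w • x‖ < c * ‖x‖ := by
  by_contra! hlow
  have hw0 : w ≠ 0 := by
    rintro rfl
    simp at hw
  have hp : 0 < p := lt_of_lt_of_le zero_lt_one Fact.out
  let V : SeqSpace p →L[ℂ] SeqSpace p := w⁻¹ • toeplitz p (Wiener.monomial (-1))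
  have hV : ‖V‖ ≤ 1 := by
    rw [norm_smul, norm_inv, hw, inv_one, one_mul]
    exact norm_toeplitz_monomial_le _
  have hVpow : ∀ m x, ‖(V ^ m) x‖ ≤ ‖x‖ := by
    intro m
    induction m with
    | zero => intro x; simp
    | succ m ih =>
      intro x
      rw [pow_succ]
      exact (ih (V x)).trans (by simpa using V.le_of_opNorm_le hV x)
  have hlow' : ∀ x, c * ‖x‖ ≤ ‖(V - 1) x‖ := fun x => by
    have h1 : (V - 1) x = w⁻¹ • (toeplitz p (Wiener.monomial (-1)) x - w • x) := by
      rw [smul_sub, smul_smul, inv_mul_cancel₀ hw0, one_smul]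
      rfl
    rw [h1, norm_smul, norm_inv, hw, inv_one, one_mul]
    exact hlow x
  let e : SeqSpace p := lp.single p 0 (1 : ℂ)
  have he : ‖e‖ = 1 := by simp [e, lp.norm_single hp]
  have hcoord : ∀ m i : ℕ, (V ^ m) e i = if i = m then w⁻¹ ^ m else 0 := by
    intro m
    induction m with
    | zero =>
      intro i
      by_cases hi : i = 0
      · subst hi
        simp [e]
      · rw [if_neg hi]
        exact lp.single_apply_ne p 0 _ hi
    | succ m ih =>
      intro i
      rw [pow_succ']
      change w⁻¹ * toeplitz p (Wiener.monomial (-1)) ((V ^ m) e) i = _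
      rw [toeplitz_monomial_apply, zshift]
      split_ifs with h1 h2 h2
      · rw [ih, if_pos (by omega), pow_succ']
      · rw [ih, if_neg (by omega), mul_zero]
      · omega
      · exact mul_zero _
  have hbound : ∀ n : ℕ, c ^ 2 * (n + 1) ≤ 4 := by
    intro n
    let Q : SeqSpace p →L[ℂ] SeqSpace p := ∑ m ∈ Finset.range (n + 1), V ^ m
    have hQ : ∀ x, c * ‖Q x‖ ≤ 2 * ‖x‖ := fun x => by
      have h1 : (V - 1) (Q x) = (V ^ (n + 1)) x - x := by
        have := mul_geom_sum V (n + 1)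
        exact congrArg (fun T : SeqSpace p →L[ℂ] SeqSpace p => T x) this
      calc c * ‖Q x‖ ≤ ‖(V ^ (n + 1)) x - x‖ := h1 ▸ hlow' (Q x)
        _ ≤ ‖(V ^ (n + 1)) x‖ + ‖x‖ := norm_sub_le _ _
        _ ≤ 2 * ‖x‖ := by linarith [hVpow (n + 1) x]
    have hQQ : Q (Q e) n = (n + 1) * w⁻¹ ^ n := by
      have h1 : Q (Q e) = ∑ m ∈ Finset.range (n + 1), ∑ j ∈ Finset.range (n + 1),
          (V ^ (j + m)) e := by
        simp only [Q, sum_apply, map_sum, pow_add]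
        rfl
      have h2 : Q (Q e) n = ∑ m ∈ Finset.range (n + 1), ∑ j ∈ Finset.range (n + 1),
          (V ^ (j + m)) e n := by
        rw [h1]
        change lp.evalCLM ℂ (fun _ : ℕ => ℂ) p n _ = _
        simp only [map_sum]
        rfl
      have h3 : ∀ m ∈ Finset.range (n + 1), ∑ j ∈ Finset.range (n + 1),
          (V ^ (j + m)) e n = w⁻¹ ^ n := fun m hm => by
        rw [Finset.mem_range] at hm
        rw [Finset.sum_eq_single (n - m)]
        · rw [hcoord, if_pos (by omega)]
          congr 1
          omega
        · intro j _ hj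
          rw [hcoord, if_neg (by omega)]
        · intro hj
          exact absurd (Finset.mem_range.2 (by omega)) hj
      rw [h2, Finset.sum_congr rfl h3]
      simp
    have hnorm : ((n : ℝ) + 1) ≤ ‖Q (Q e)‖ := by
      have h1 := lp.norm_apply_le_norm hp.ne' (Q (Q e)) n
      rw [hQQ, norm_mul, norm_pow, norm_inv, hw, inv_one, one_pow, mul_one] at h1
      have h2 : ‖((n : ℂ) + 1)‖ = n + 1 := by
        exact_mod_cast Complex.norm_natCast (n + 1)
      rwa [h2] at h1
    have h1 := hQ (Q e)
    have h2 := hQ e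
    rw [he] at h2
    calc c ^ 2 * (n + 1) = c * (c * (n + 1)) := by ring
      _ ≤ c * (c * ‖Q (Q e)‖) := by gcongr
      _ ≤ c * (2 * ‖Q e‖) := by gcongr
      _ ≤ 4 := by linarith
  obtain ⟨n, hn⟩ := exists_nat_gt (4 / c ^ 2)
  have hc2 : 0 < c ^ 2 := by positivity
  rw [div_lt_iff₀ hc2] at hn
  nlinarith [hbound n]

open Filter Topology

theorem exists_approximate_eigenvectors_shift {w : ℂ} (hw : ‖w‖ = 1) :
    ∃ x : ℕ → SeqSpace p, (∀ n, ‖x n‖ = 1) ∧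
      Tendsto (fun n => toeplitz p (Wiener.monomial (-1)) (x n) - w • x n) atTop (𝓝 0) := by
  have h : ∀ n : ℕ, ∃ x : SeqSpace p, ‖x‖ = 1 ∧
      ‖toeplitz p (Wiener.monomial (-1)) x - w • x‖ ≤ 1 / ((n : ℝ) + 1) := by
    intro n
    obtain ⟨y, hy⟩ := exists_norm_shift_sub_lt (p := p) hw (c := 1 / ((n : ℝ) + 1)) (by positivity)
    have hy0 : ‖y‖ ≠ 0 := by
      intro h0
      rw [h0, mul_zero] at hy
      exact absurd hy (norm_nonneg _).not_gt
    have hn : ‖((‖y‖ : ℂ)⁻¹)‖ = ‖y‖⁻¹ := by simp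
    refine ⟨(‖y‖ : ℂ)⁻¹ • y, ?_, ?_⟩
    · rw [norm_smul, hn, inv_mul_cancel₀ hy0]
    · rw [map_smul, smul_comm, ← smul_sub, norm_smul, hn, inv_mul_le_iff₀ (by positivity), mul_comm]
      exact hy.le
  choose x hx1 hx2 using h
  exact ⟨x, hx1, squeeze_zero_norm hx2 tendsto_one_div_add_atTop_nhds_zero_nat⟩

/-- Approximate eigenvectors of the forward shift are approximate eigenvectors of all Toeplitz
operators. -/
theorem tendsto_toeplitz_sub_eval {z : ℂ} (hz : ‖z‖ = 1) {x : ℕ → SeqSpace p}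
    (hx : ∀ n, ‖x n‖ = 1)
    (hU : Tendsto (fun n => toeplitz p (Wiener.monomial (-1)) (x n) - z⁻¹ • x n) atTop (𝓝 0))
    (a : Wiener) : Tendsto (fun n => toeplitz p a (x n) - a.eval z • x n) atTop (𝓝 0) := by
  have hz0 : z ≠ 0 := by
    rintro rfl
    simp at hz
  have hcomp : ∀ (k : ℤ) {y : ℕ → SeqSpace p}, Tendsto y atTop (𝓝 0) →
      Tendsto (fun n => toeplitz p (Wiener.monomial k) (y n)) atTop (𝓝 0) := fun k y hy => by
    have h := ((toeplitz p (Wiener.monomial k)).continuous.tendsto 0).comp hy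
    rw [map_zero] at h
    exact h
  have hsmul : ∀ (r : ℂ) {y : ℕ → SeqSpace p}, Tendsto y atTop (𝓝 0) →
      Tendsto (fun n => r • y n) atTop (𝓝 0) := fun r y hy => by
    simpa using hy.const_smul r
  have h1 : Tendsto (fun n => toeplitz p (Wiener.monomial 1) (x n) - z • x n) atTop (𝓝 0) := by
    refine (hsmul (-z) (hcomp 1 hU)).congr fun n => ?_
    rw [map_sub, toeplitz_monomial_comp _ _ (Or.inl zero_le_one), map_smul, add_neg_cancel,
      toeplitz_monomial_zero, smul_sub, smul_smul, neg_mul, mul_inv_cancel₀ hz0]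
    module
  have hk : ∀ k : ℤ, Tendsto (fun n => toeplitz p (Wiener.monomial k) (x n) - z ^ k • x n)
      atTop (𝓝 0) := by
    intro k
    induction k using Int.induction_on with
    | zero => simp [toeplitz_monomial_zero]
    | succ k ih =>
      have h2 := (hcomp k h1).add (hsmul z ih)
      rw [add_zero] at h2
      refine h2.congr fun n => ?_
      rw [map_sub, toeplitz_monomial_comp _ _ (Or.inl (by omega)), map_smul, zpow_add₀ hz0,
        zpow_one]
      module
    | pred k ih =>
      have h2 := (hcomp (-k) hU).add (hsmul z⁻¹ ih)
      rw [add_zero] at h2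
      refine h2.congr fun n => ?_
      rw [map_sub, toeplitz_monomial_comp _ _ (Or.inr (by omega)), map_smul,
        sub_eq_add_neg (-(k : ℤ)), zpow_add₀ hz0, zpow_neg_one]
      module
  let Ψ : ℕ → Wiener →L[ℂ] SeqSpace p := fun n =>
    (toeplitzCLM p).flip (x n) - (Wiener.evalCLM z hz).smulRight (x n)
  have hΨ : ∀ n b, Ψ n b = toeplitz p b (x n) - b.eval z • x n := fun n b => rfl
  have hΨk : ∀ n k, Ψ n (Wiener.monomial k)
      = toeplitz p (Wiener.monomial k) (x n) - z ^ k • x n := fun n k => by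
    rw [hΨ, ← Wiener.evalCLM_apply z hz, Wiener.evalCLM, Wiener.lift_monomial]
  have hsum : ∀ n, ∑' k, a k • Ψ n (Wiener.monomial k)
      = toeplitz p a (x n) - a.eval z • x n := fun n => by
    rw [← hΨ]
    simpa using ((Wiener.hasSum_monomial a).mapL (Ψ n)).tsum_eq
  have hbound : ∀ n k, ‖a k • Ψ n (Wiener.monomial k)‖ ≤ ‖a k‖ * 2 := fun n k => by
    rw [norm_smul, hΨk]
    have h2 : ‖toeplitz p (Wiener.monomial k) (x n)‖ ≤ 1 := by
      simpa [hx n] using (toeplitz p (Wiener.monomial k)).le_of_opNorm_le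
        (norm_toeplitz_monomial_le k) (x n)
    have h3 : ‖z ^ k • x n‖ = 1 := by rw [norm_smul, norm_zpow, hz, one_zpow, hx n, one_mul]
    gcongr
    calc _ ≤ _ := norm_sub_le _ _
      _ ≤ 2 := by linarith
  have hlim := tendsto_tsum_of_dominated_convergence (𝓕 := atTop)
    (f := fun n k => a k • Ψ n (Wiener.monomial k)) (g := fun _ => (0 : SeqSpace p))
    (a.summable_norm.mul_right 2)
    (fun k => hsmul (a k) ((hk k).congr fun n => (hΨk n k).symm))
    (Eventually.of_forall fun n k => hbound n k)
  rw [tsum_zero] at hlim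
  exact hlim.congr hsum

/-- The forward shift has no eigenvectors with nonzero eigenvalue. -/
theorem eq_zero_of_shift_eq_smul {w : ℂ} (hw : w ≠ 0) {x : SeqSpace p}
    (h : toeplitz p (Wiener.monomial (-1)) x = w • x) : x = 0 := by
  have hi : ∀ i : ℕ, zshift (-1) x i = w * x i := fun i => by
    rw [← toeplitz_monomial_apply, h]
    rfl
  ext i
  induction i with
  | zero =>
    have := hi 0
    rw [zshift, if_neg (by omega)] at this
    exact (mul_eq_zero.1 this.symm).resolve_left hw
  | succ i ih =>
    have := hi (i + 1)
    rw [zshift, if_pos (by omega), show (((i + 1 : ℕ) : ℤ) + -1).toNat = i by omega, ih] at this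
    exact (mul_eq_zero.1 this.symm).resolve_left hw

/-- The values of the symbol on the unit circle lie in the spectrum of every compact perturbation
of the Toeplitz operator. If the perturbed operator minus `a(z)` were invertible, compactness would
make the approximate eigenvectors of the forward shift subconverge to an eigenvector. -/
theorem eval_mem_spectrum_toeplitz_add (a : Wiener) {E : SeqSpace p →L[ℂ] SeqSpace p}
    (hE : IsCompactOperator E) {z : ℂ} (hz : ‖z‖ = 1) :
    a.eval z ∈ spectrum ℂ (toeplitz p a + E) := by
  have hz0 : z ≠ 0 := by
    rintro rfl
    simp at hz
  rintro ⟨G, hG⟩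
  obtain ⟨x, hx1, hxU⟩ :=
    exists_approximate_eigenvectors_shift (p := p) (w := z⁻¹) (by simp [hz])
  have hxa := tendsto_toeplitz_sub_eval hz hx1 hxU a
  obtain ⟨K, hK, hEK⟩ := hE.image_closedBall_subset_compact
    (f := (E : SeqSpace p →ₗ[ℂ] SeqSpace p)) 1
  obtain ⟨y, -, φ, hφ, hy⟩ := hK.tendsto_subseq (x := fun n => E (x n)) fun n =>
    hEK ⟨x n, by simp [hx1 n], rfl⟩
  let H : SeqSpace p →L[ℂ] SeqSpace p := ↑G⁻¹
  have hH : ∀ v, H (a.eval z • v - (toeplitz p a v + E v)) = v := fun v => by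
    have h1 : (↑G⁻¹ : SeqSpace p →L[ℂ] SeqSpace p)
        * (algebraMap ℂ _ (a.eval z) - (toeplitz p a + E)) = 1 := by
      rw [← hG, Units.inv_mul]
    exact congrArg (fun T : SeqSpace p →L[ℂ] SeqSpace p => T v) h1
  have hlim : Tendsto (fun n => x (φ n)) atTop (𝓝 (H (-0 - y))) := by
    refine ((H.continuous.tendsto _).comp
      ((hxa.comp hφ.tendsto_atTop).neg.sub hy)).congr fun n => ?_
    have h1 : -(toeplitz p a (x (φ n)) - a.eval z • x (φ n)) - E (x (φ n))
        = a.eval z • x (φ n) - (toeplitz p a (x (φ n)) + E (x (φ n))) := by abel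
    exact (congrArg H h1).trans (hH _)
  set v := H (-0 - y)
  have hv1 : ‖v‖ = 1 := tendsto_nhds_unique hlim.norm (by simp [hx1])
  have hvU : toeplitz p (Wiener.monomial (-1)) v - z⁻¹ • v = 0 :=
    tendsto_nhds_unique
      ((((toeplitz p (Wiener.monomial (-1))).continuous.tendsto v).comp hlim).sub
        (hlim.const_smul z⁻¹)) (hxU.comp hφ.tendsto_atTop)
  rw [eq_zero_of_shift_eq_smul (inv_ne_zero hz0) (sub_eq_zero.1 hvU), norm_zero] at hv1
  exact zero_ne_one hv1

end Toeplitz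

/-! ### Quasi-Toeplitz solutions of Sylvester equations -/

theorem mainTheorem3 (p : ENNReal) [Fact (1 ≤ p)]
    (A B C : SeqSpace p →L[ℂ] SeqSpace p)
    (hspec : spectrum ℂ A ∩ spectrum ℂ (-B) = ∅)
    (a b c : Wiener) (Ea Eb Ec : SeqSpace p →L[ℂ] SeqSpace p)
    (hEa : IsCompactOperator Ea) (hEb : IsCompactOperator Eb) (hEc : IsCompactOperator Ec)
    (hA : A = toeplitz p a + Ea) (hB : B = toeplitz p b + Eb) (hC : C = toeplitz p c + Ec) :
    (∃! X, SolvesSylvester A B C X) ∧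
    (∀ z : ℂ, ‖z‖ = 1 → a.eval z + b.eval z ≠ 0) ∧
    ∀ X, SolvesSylvester A B C X →
      X ∈ QT p ∧
      ∃ (x : Wiener) (Ex : SeqSpace p →L[ℂ] SeqSpace p),
        (∀ z : ℂ, ‖z‖ = 1 → x.eval z = -c.eval z * (a.eval z + b.eval z)⁻¹) ∧
        IsCompactOperator Ex ∧
        X = toeplitz p x + Ex ∧
        SolvesSylvester A B (C + A ∘L toeplitz p x + toeplitz p x ∘L B) Ex := by
  have hclosed : IsClosed (compactOperator (RingHom.id ℂ) (SeqSpace p) (SeqSpace p) :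
      Set (SeqSpace p →L[ℂ] SeqSpace p)) := isClosed_setOfPred_isCompactOperator
  have hne : ∀ z : ℂ, ‖z‖ = 1 → a.eval z + b.eval z ≠ 0 := by
    intro z hz h0
    have h1 : a.eval z ∈ spectrum ℂ A := hA ▸ eval_mem_spectrum_toeplitz_add a hEa hz
    have h2 : Wiener.eval (-b) z ∈ spectrum ℂ (-B) := by
      have hB' : -B = toeplitz p (-b) + -Eb := by
        rw [hB, neg_add, ← toeplitzCLM_apply (-b), map_neg, toeplitzCLM_apply]
      rw [hB']
      exact eval_mem_spectrum_toeplitz_add (-b) hEb.neg hz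
    rw [Wiener.eval_neg b hz, ← eq_neg_of_add_eq_zero_left h0] at h2
    exact (hspec ▸ Set.mem_inter h1 h2 : a.eval z ∈ (∅ : Set ℂ))
  have huniq : ∃! X, SolvesSylvester A B C X := by
    obtain ⟨X, ⟨-, hX⟩, hu⟩ := existsUnique_sylvester_of_disjoint_spectrum
      (⊤ : Submodule ℂ (SeqSpace p →L[ℂ] SeqSpace p)) isClosed_univ (fun _ _ _ => trivial)
      (fun _ _ _ => trivial) hspec (K := -C) trivial
    exact ⟨X, add_eq_zero_iff_eq_neg.2 hX, fun Y hY => hu Y ⟨trivial, add_eq_zero_iff_eq_neg.1 hY⟩⟩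
  refine ⟨huniq, hne, fun X hX => ?_⟩
  -- By Wiener's lemma, multiplication by `a + b` is invertible on the Wiener class.
  obtain ⟨u, hu⟩ := Wiener.isUnit_conv (f := a + b) fun z hz => by
    rw [Wiener.eval_add a b hz]
    exact hne z hz
  let x : Wiener := (↑u⁻¹ : Wiener →L[ℂ] Wiener) (-c)
  have hx : Wiener.conv (a + b) x = -c := by
    rw [← hu]
    exact congrArg (fun T : Wiener →L[ℂ] Wiener => T (-c)) u.mul_inv
  have hxeval : ∀ z : ℂ, ‖z‖ = 1 → x.eval z = -c.eval z * (a.eval z + b.eval z)⁻¹ := by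
    intro z hz
    rw [eq_mul_inv_iff_mul_eq₀ (hne z hz), ← Wiener.eval_add a b hz, mul_comm,
      ← Wiener.eval_conv _ _ hz, hx, Wiener.eval_neg c hz]
  have hTc : toeplitz p c = -(toeplitz p (Wiener.conv x a) + toeplitz p (Wiener.conv b x)) := by
    have h1 : c = -(Wiener.conv x a + Wiener.conv b x) := by
      rw [Wiener.conv_comm x a, ← add_apply, ← map_add, hx, neg_neg]
    have h2 := congrArg (toeplitzCLM p) h1
    rwa [map_neg, map_add] at h2
  -- The symbol of the residual of `T(x)` is `c + a x + x b = 0`.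
  have hK : IsCompactOperator (-(C + A ∘L toeplitz p x + toeplitz p x ∘L B)) := by
    have h1 := isCompactOperator_toeplitz_conv_sub (p := p) x a
    have h2 := isCompactOperator_toeplitz_conv_sub (p := p) b x
    have h3 := hEa.comp_clm (toeplitz p x)
    have h4 := hEb.clm_comp (toeplitz p x)
    refine Eq.subst (motive := fun f : SeqSpace p → SeqSpace p => IsCompactOperator f)
      (funext fun v => ?_) ((((h1.add h2).sub hEc).sub h3).sub h4)
    simp only [hA, hB, hC, hTc, add_apply, neg_apply,
      sub_apply, ContinuousLinearMap.comp_apply, Pi.add_apply, Pi.sub_apply,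
      Function.comp_apply, map_add]
    abel
  -- The correction equation has a compact solution and, by uniqueness, only that one.
  obtain ⟨Ex, ⟨hEx, hExK⟩, -⟩ := existsUnique_sylvester_of_disjoint_spectrum _ hclosed
    (fun T k hk => IsCompactOperator.clm_comp hk T) (fun T k hk => IsCompactOperator.comp_clm hk T)
    hspec (show _ ∈ compactOperator (RingHom.id ℂ) (SeqSpace p) (SeqSpace p) from hK)
  have hExS : SolvesSylvester A B (C + A ∘L toeplitz p x + toeplitz p x ∘L B) Ex :=
    add_eq_zero_iff_eq_neg.2 hExK
  have hXE : X = toeplitz p x + Ex := by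
    refine huniq.unique hX ?_
    unfold SolvesSylvester at hExS ⊢
    rw [← hExS, ContinuousLinearMap.comp_add, ContinuousLinearMap.add_comp]
    abel
  exact ⟨⟨x, Ex, hEx, hXE⟩, x, Ex, hxeval, hEx, hXE, hExS⟩
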